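/- Let $M$ be an $n$-dimensional smooth Riemannian manifold with Riemannian distance $d$ (the infimum of the lengths of curves; $d=\infty$ between different connected components). Let $w_1,\dots,w_t>0$, and for $\{x\}=(x^{(1)},\dots,x^{(t)})\in M^t$ and $y\in M$ put $$f(\{x\},y)=\sum_{l=1}^t w_l\, d(x^{(l)},y)^2 .$$ Fix $\{x\}\in M^t$ and let $\mu_{fr}$ be a Fréchet mean map near $\{x\}$: for all $\{x'\}$ in a neighbourhood of $\{x\}$ the point $\mu_{fr}(\{x'\})$ is a minimizer over $y\in M$ of $f(\{x'\},y)$, and $\overline{x}=\mu_{fr}(\{x\})$ is the only minimizer of $f(\{x\},\cdot)$. Suppose that $M$ is complete or that $\mu_{fr}$ is continuous at $\{x\}$. Take arbitrary smooth charts of $M$ around each $x^{(l)}$ and around $\overline{x}$. In these local coordinates let $\nabla_y f$ be the vector of partial derivatives of $f$ in $y$, let $f_{YY}=\nabla^2_{yy}f$ be the Hessian matrix in $y$, and let $f_{X^{(i)}Y}=\widetilde\nabla_{x^{(i)}}\nabla_y f$ be the Jacobian of $\nabla_y f$ with respect to $x^{(i)}$. Suppose that $f$ is twice differentiable at $(\{x\},\overline{x})$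 (that is, differentiable in a neighbourhood, with derivative differentiable at this point) and that $f_{YY}(\{x\},\overline{x})$ is invertible. Then $\mu_{fr}$ is continuous at $\{x\}$ and, in the local coordinates, differentiable at $\{x\}$, and for every $i=1,\dots,t$ its Jacobian with respect to $x^{(i)}$ is $$\widetilde\nabla_{x^{(i)}}\mu_{fr}(\{x\})=-f_{YY}(\{x\},\overline{x})^{-1}\, f_{X^{(i)}Y}(\{x\},\overline{x}).$$ -/

import Mathlib

open Bundle Set Filter
open scoped Manifold ContDiff Topology ENNReal

/-- The weighted Fréchet objective `f({x}, y) = ∑ₗ wₗ d(x⁽ˡ⁾, y)²`. The distance of two points in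
different connected components of a Riemannian manifold is `∞`, so `f` takes values in `[0, ∞]`. -/
noncomputable def frechetObjective {M : Type*} [EMetricSpace M] {t : ℕ} (w : Fin t → ℝ)
    (x : Fin t → M) (y : M) : ℝ≥0∞ :=
  ∑ l, ENNReal.ofReal (w l) * edist (x l) y ^ 2

/-- The set `argmin_{y ∈ M} f({x}, y)`. -/
def frechetArgmin {M : Type*} [EMetricSpace M] {t : ℕ} (w : Fin t → ℝ) (x : Fin t → M) : Set M :=
  {y | ∀ z, frechetObjective w x y ≤ frechetObjective w x z}

/-- The objective `f` as a real function of the local coordinates `u⁽ˡ⁾ = φₗ(x⁽ˡ⁾)` and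
`v = ψ(y)`, with a chart `φₗ` for each data point and a chart `ψ` for `y`. -/
noncomputable def coordObjective {M : Type*} [EMetricSpace M] {n t : ℕ} (w : Fin t → ℝ)
    (φ : Fin t → OpenPartialHomeomorph M (EuclideanSpace ℝ (Fin n)))
    (ψ : OpenPartialHomeomorph M (EuclideanSpace ℝ (Fin n)))
    (u : Fin t → EuclideanSpace ℝ (Fin n)) (v : EuclideanSpace ℝ (Fin n)) : ℝ :=
  (frechetObjective w (fun l ↦ (φ l).symm (u l)) (ψ.symm v)).toReal

/-- A map `μ : Mᵗ → M` in the local coordinates given by the charts `φₗ` and `ψ`. -/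
def coordMap {M : Type*} [TopologicalSpace M] {n t : ℕ}
    (φ : Fin t → OpenPartialHomeomorph M (EuclideanSpace ℝ (Fin n)))
    (ψ : OpenPartialHomeomorph M (EuclideanSpace ℝ (Fin n))) (μ : (Fin t → M) → M)
    (u : Fin t → EuclideanSpace ℝ (Fin n)) : EuclideanSpace ℝ (Fin n) :=
  ψ (μ fun l ↦ (φ l).symm (u l))

/-- `F` is twice differentiable at `p`: it is differentiable near `p`, and its derivative is
differentiable at `p`. -/
def TwiceDifferentiableAt {V : Type*} [NormedAddCommGroup V] [NormedSpace ℝ V]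
    (F : V → ℝ) (p : V) : Prop :=
  (∀ᶠ q in 𝓝 p, DifferentiableAt ℝ F q) ∧ DifferentiableAt ℝ (fderiv ℝ F) p

/-- `F_YY(u, v) = ∇²_{vv} F(u, v)`, the Hessian in `v`: the Jacobian of `v ↦ ∇_v F(u, v)`. -/
noncomputable def hessYY {n t : ℕ}
    (F : (Fin t → EuclideanSpace ℝ (Fin n)) → EuclideanSpace ℝ (Fin n) → ℝ)
    (u : Fin t → EuclideanSpace ℝ (Fin n)) (v : EuclideanSpace ℝ (Fin n)) :
    EuclideanSpace ℝ (Fin n) →L[ℝ] EuclideanSpace ℝ (Fin n) :=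
  fderiv ℝ (fun b ↦ gradient (F u) b) v

/-- `F_{X⁽ⁱ⁾Y}(u, v)`: the Jacobian of `∇_v F(u, v)` in the `i`-th block `u⁽ⁱ⁾`. -/
noncomputable def mixedXY {n t : ℕ}
    (F : (Fin t → EuclideanSpace ℝ (Fin n)) → EuclideanSpace ℝ (Fin n) → ℝ) (i : Fin t)
    (u : Fin t → EuclideanSpace ℝ (Fin n)) (v : EuclideanSpace ℝ (Fin n)) :
    EuclideanSpace ℝ (Fin n) →L[ℝ] EuclideanSpace ℝ (Fin n) :=
  fderiv ℝ (fun a ↦ gradient (F (Function.update u i a)) v) (u i)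

/-! The minimizer satisfies the first-order condition ∇_y f = 0 near the data, and differentiating
this equation implicitly gives the formula. Since ∇_y f is only differentiable at one point, the
classical implicit function theorem does not apply; `HasFDerivAt.of_implicit` uses instead that a
continuous solution is already given. When M is complete, continuity comes from Hopf–Rinow: nearby
minimizers stay in a compact ball, and their cluster points minimize the limiting objective, whose
minimizer is unique. -/

open Manifold in
/-- A Riemannian manifold is a length space: a point at distance `< a + b` from `x` is at distance
`< b` from some point of the closed ball of radius `a` around `x`. -/
theorem IsRiemannianManifold.exists_edist_le_edist_lt {E H M : Type*} [NormedAddCommGroup E]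
    [NormedSpace ℝ E] [TopologicalSpace H] (I : ModelWithCorners ℝ E H) [EMetricSpace M]
    [ChartedSpace H M] [RiemannianBundle (fun (p : M) ↦ TangentSpace I p)]
    [IsRiemannianManifold I M] {x y : M} {a b : ℝ≥0∞} (ha : a ≠ ⊤) (hb : 0 < b)
    (h : edist x y < a + b) : ∃ z, edist x z ≤ a ∧ edist z y < b := by
  rcases le_total (edist x y) a with hxy | hxy
  · exact ⟨y, hxy, by simpa using hb⟩
  rw [IsRiemannianManifold.out (I := I)] at h
  obtain ⟨γ, h0, h1, hγ, hlen⟩ := exists_lt_of_riemannianEDist_lt h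
  have hcont : ContinuousOn (fun s ↦ edist x (γ s)) (Icc (0 : ℝ) 1) :=
    (continuous_const.edist continuous_id).comp_continuousOn hγ.continuousOn
  -- Cut an almost shortest curve where its distance from `x` is exactly `a`; its first piece has
  -- length at least `a`, so less than `b` remains.
  obtain ⟨s, hs, hsa⟩ : a ∈ (fun s ↦ edist x (γ s)) '' Icc (0 : ℝ) 1 :=
    intermediate_value_Icc zero_le_one hcont (by simpa [h0, h1] using hxy)
  refine ⟨γ s, hsa.le, ?_⟩
  have l0 : a ≤ pathELength I γ 0 s := by
    refine hsa.ge.trans ?_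
    change edist x (γ s) ≤ _
    rw [IsRiemannianManifold.out (I := I)]
    exact riemannianEDist_le_pathELength (hγ.mono (Icc_subset_Icc_right hs.2)) h0 rfl hs.1
  have l1 : edist (γ s) y ≤ pathELength I γ s 1 := by
    rw [IsRiemannianManifold.out (I := I)]
    exact riemannianEDist_le_pathELength (hγ.mono (Icc_subset_Icc_left hs.1)) rfl h1 hs.2
  rw [← pathELength_add hs.1 hs.2] at hlen
  exact (ENNReal.add_lt_add_iff_left ha).1 ((add_le_add l0 l1).trans_lt hlen)

open scoped NNReal in
/-- **Hopf–Rinow–Cohn-Vossen**: in a complete locally compact length space, closed balls of finite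
radius are compact. -/
theorem isCompact_closedEBall_of_length_space {M : Type*} [EMetricSpace M] [CompleteSpace M]
    [LocallyCompactSpace M]
    (hM : ∀ (x y : M) (a b : ℝ≥0∞), a ≠ ⊤ → 0 < b → edist x y < a + b →
      ∃ z, edist x z ≤ a ∧ edist z y < b) (x : M) (r : ℝ≥0) :
    IsCompact (Metric.closedEBall x r) := by
  by_contra hr
  set S : Set ℝ≥0 := {s | IsCompact (Metric.closedEBall x s)} with hS
  have hdown : ∀ s ∈ S, ∀ s' ≤ s, s' ∈ S := fun s hs s' h ↦
    IsCompact.of_isClosed_subset hs Metric.isClosed_closedEBall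
      (Metric.closedEBall_subset_closedEBall (by exact_mod_cast h))
  have h0 : (0 : ℝ≥0) ∈ S := by simp [hS]
  have hbdd : BddAbove S := ⟨r, fun s hs ↦ by
    by_contra hlt
    exact hr (hdown s hs r (not_le.1 hlt).le)⟩
  have hlt : ∀ s < sSup S, s ∈ S := fun s hs ↦ by
    obtain ⟨s', hs', hss'⟩ := exists_lt_of_lt_csSup ⟨0, h0⟩ hs
    exact hdown s' hs' s hss'.le
  have hmem : sSup S ∈ S := by
    refine TotallyBounded.isCompact_of_isClosed ?_ Metric.isClosed_closedEBall
    refine EMetric.totallyBounded_iff.2 fun ε hε ↦ ?_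
    obtain ⟨η, hη, hηε⟩ := ENNReal.lt_iff_exists_nnreal_btwn.1 (ENNReal.half_pos hε.ne')
    have hη0 : 0 < η := by exact_mod_cast hη
    -- Subtraction is truncated, so a zero supremum needs its own case.
    have hR : sSup S - η ∈ S := by
      rcases eq_or_ne (sSup S) 0 with h | h
      · simpa [h] using h0
      · exact hlt _ (tsub_lt_self (pos_iff_ne_zero.2 h) hη0)
    obtain ⟨t, ht, hcov⟩ :=
      EMetric.totallyBounded_iff.1 (IsCompact.totallyBounded hR) (ε / 2) (ENNReal.half_pos hε.ne')
    refine ⟨t, ht, fun y hy ↦ ?_⟩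
    obtain ⟨z, hz, hzy⟩ := hM x y ((sSup S - η : ℝ≥0) : ℝ≥0∞) (ε / 2) ENNReal.coe_ne_top
      (ENNReal.half_pos hε.ne') (by
        refine lt_of_le_of_lt (b := ((sSup S - η : ℝ≥0) : ℝ≥0∞) + η) ?_
          ((ENNReal.add_lt_add_iff_left ENNReal.coe_ne_top).2 hηε)
        rw [edist_comm]
        refine (Metric.mem_closedEBall.1 hy).trans ?_
        exact_mod_cast le_tsub_add)
    have hzt := hcov (a := z) (by rwa [Metric.mem_closedEBall, edist_comm])
    simp only [mem_iUnion, Metric.mem_eball] at hzt ⊢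
    obtain ⟨p, hp, hzp⟩ := hzt
    refine ⟨p, hp, (edist_triangle y z p).trans_lt ?_⟩
    rw [← ENNReal.add_halves ε, edist_comm y z]
    exact ENNReal.add_lt_add hzy hzp
  -- Local compactness allows the radius to grow beyond the supremum; `δ / 2` leaves room for the
  -- strict inequality in `hM`.
  obtain ⟨δ, hδ, hcomp⟩ := IsCompact.exists_isCompact_cthickening hmem
  lift δ to ℝ≥0 using hδ.le
  have hδ' : 0 < δ := by exact_mod_cast hδ
  have hmem' : sSup S + δ / 2 ∈ S := by
    refine IsCompact.of_isClosed_subset hcomp Metric.isClosed_closedEBall fun y hy ↦ ?_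
    have hlt : sSup S + δ / 2 < sSup S + δ := by
      gcongr
      exact NNReal.half_lt_self hδ'.ne'
    obtain ⟨z, hz, hzy⟩ := hM x y (sSup S : ℝ≥0) δ ENNReal.coe_ne_top (by exact_mod_cast hδ') (by
      rw [edist_comm]
      exact (Metric.mem_closedEBall.1 hy).trans_lt (by exact_mod_cast hlt))
    refine Metric.mem_cthickening_of_edist_le y z δ _ ?_ ?_
    · rwa [Metric.mem_closedEBall, edist_comm]
    · rw [edist_comm]
      simpa using hzy.le
  have := le_csSup hbdd hmem'
  exact absurd this (not_le.2 (lt_add_of_pos_right _ (by positivity)))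

theorem continuous_frechetObjective {M : Type*} [EMetricSpace M] {t : ℕ} (w : Fin t → ℝ) :
    Continuous fun p : (Fin t → M) × M ↦ frechetObjective w p.1 p.2 := by
  unfold frechetObjective
  refine continuous_finsetSum _ fun l _ ↦ ?_
  refine (ENNReal.continuous_const_mul ENNReal.ofReal_ne_top).comp
    ((ENNReal.continuous_pow 2).comp ?_)
  exact ((continuous_apply l).comp continuous_fst).edist continuous_snd

/-- If the minimizer is unique, the minimum is finite. -/
theorem frechetObjective_ne_top {M : Type*} [EMetricSpace M] {t : ℕ} {w : Fin t → ℝ}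
    {x : Fin t → M} {y : M} (hy : frechetArgmin w x = {y}) : frechetObjective w x y ≠ ⊤ := by
  intro htop
  have hmem : y ∈ frechetArgmin w x := by simp [hy]
  -- With an infinite minimum every point is a minimizer, so M is a single point, where the
  -- objective vanishes.
  have hall : ∀ z, z = y := fun z ↦ by
    have : z ∈ frechetArgmin w x := fun z' ↦ by
      have := hmem z'
      rw [htop, top_le_iff] at this
      simp [this]
    simpa [hy] using this
  have : frechetObjective w x y = 0 := by simp [frechetObjective, fun l ↦ hall (x l)]
  simp [this] at htop

/-- In a space whose closed balls of finite radius are compact, a selection of minimizers is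
continuous at data with a unique minimizer. -/
theorem continuousAt_of_mem_frechetArgmin {M : Type*} [EMetricSpace M] {t : ℕ}
    (hM : ∀ (p : M) (r : NNReal), IsCompact (Metric.closedEBall p r)) {w : Fin t → ℝ}
    (hw : ∀ l, 0 < w l) {x : Fin t → M} {μ : (Fin t → M) → M}
    (hμ : ∀ᶠ x' in 𝓝 x, μ x' ∈ frechetArgmin w x') (hμx : frechetArgmin w x = {μ x}) :
    ContinuousAt μ x := by
  rcases Nat.eq_zero_or_pos t with rfl | ht
  · exact continuous_of_discreteTopology.continuousAt
  have hcont := continuous_frechetObjective (M := M) w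
  have hfin := frechetObjective_ne_top hμx
  set c := frechetObjective w x (μ x)
  let l : Fin t := ⟨0, ht⟩
  have hwl : ENNReal.ofReal (w l) ≠ 0 := by simpa using hw l
  set K : ℝ≥0∞ := (c + 1) / ENNReal.ofReal (w l)
  have hK : K ≠ ⊤ := ENNReal.div_ne_top (by simp [hfin]) hwl
  have hlt : ∀ᶠ x' in 𝓝 x, frechetObjective w x' (μ x) < c + 1 :=
    (hcont.comp (continuous_id.prodMk continuous_const)).continuousAt.eventually_lt
      continuousAt_const (ENNReal.lt_add_right hfin one_ne_zero)
  have hnear : ∀ᶠ x' in 𝓝 x, edist (x l) (x' l) < 1 :=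
    (continuous_const.edist (continuous_apply l)).continuousAt.eventually_lt
      continuousAt_const (by simp)
  have hball : ∀ᶠ x' in 𝓝 x, μ x' ∈ Metric.closedEBall (x l) ((1 + (K + 1)).toNNReal) := by
    filter_upwards [hμ, hlt, hnear] with x' h1 h2 h3
    rw [ENNReal.coe_toNNReal (by simp [hK]), Metric.mem_closedEBall, edist_comm]
    refine (edist_triangle (x l) (x' l) (μ x')).trans (add_le_add h3.le ?_)
    have hsq : edist (x' l) (μ x') ^ 2 ≤ K := by
      rw [ENNReal.le_div_iff_mul_le (.inl hwl) (.inl ENNReal.ofReal_ne_top), mul_comm]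
      refine le_trans ?_ ((h1 (μ x)).trans h2.le)
      exact Finset.single_le_sum (f := fun l ↦ ENNReal.ofReal (w l) * edist (x' l) (μ x') ^ 2)
        (fun _ _ ↦ zero_le) (Finset.mem_univ l)
    -- The bound d ≤ max(1, d²) avoids square roots.
    rcases le_total (edist (x' l) (μ x')) 1 with h | h
    · exact h.trans le_add_self
    · exact (le_self_pow h two_ne_zero).trans (hsq.trans le_self_add)
  refine (hM _ _).tendsto_nhds_of_unique_mapClusterPt hball fun y _ hy ↦ ?_
  obtain ⟨U, hU, hUy⟩ := mapClusterPt_iff_ultrafilter.1 hy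
  suffices y ∈ frechetArgmin w x by simpa [hμx] using this
  intro z
  have hid : Tendsto (fun x' : Fin t → M ↦ x') U (𝓝 x) := hU
  exact le_of_tendsto_of_tendsto ((hcont.tendsto (x, y)).comp (hid.prodMk_nhds hUy))
    ((hcont.tendsto (x, z)).comp (hid.prodMk_nhds tendsto_const_nhds))
    ((hμ.filter_mono hU).mono fun _ h ↦ h z)

/-- Implicit differentiation: a continuous solution `m` of `G (u, m u) = 0` is differentiable at a
point as soon as `G` is, with invertible derivative in the second variable. -/
theorem HasFDerivAt.of_implicit {X Y Z : Type*} [NormedAddCommGroup X] [NormedSpace ℝ X]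
    [NormedAddCommGroup Y] [NormedSpace ℝ Y] [NormedAddCommGroup Z] [NormedSpace ℝ Z]
    {G : X × Y → Z} {D : X × Y →L[ℝ] Z} {m : X → Y} {u : X} (hG : HasFDerivAt G D (u, m u))
    (hm : ContinuousAt m u) (hzero : ∀ᶠ a in 𝓝 u, G (a, m a) = 0) (e : Y ≃L[ℝ] Z)
    (he : D ∘L ContinuousLinearMap.inr ℝ X Y = e) :
    HasFDerivAt m (-((e.symm : Z →L[ℝ] Y) ∘L D ∘L ContinuousLinearMap.inl ℝ X Y)) u := by
  set L := (e.symm : Z →L[ℝ] Y) ∘L D ∘L ContinuousLinearMap.inl ℝ X Y with hL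
  have hpair : Tendsto (fun a ↦ (a, m a)) (𝓝 u) (𝓝 (u, m u)) := continuousAt_id.prodMk hm
  have h1 : (fun a ↦ D (a - u, m a - m u)) =o[𝓝 u] fun a ↦ (a - u, m a - m u) := by
    have := (hG.isLittleO.comp_tendsto hpair)
    refine (this.neg_left).congr' ?_ (.of_forall fun a ↦ by simp)
    filter_upwards [hzero] with a ha
    simp [ha, hzero.self_of_nhds, -map_sub]
  have h2 : (fun a ↦ m a - m u + L (a - u)) =o[𝓝 u] fun a ↦ (a - u, m a - m u) := by
    refine ((e.symm : Z →L[ℝ] Y).isBigO_comp (fun a ↦ D (a - u, m a - m u)) (𝓝 u)).trans_isLittleO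
      h1 |>.congr_left fun a ↦ ?_
    have hsplit : D (a - u, m a - m u) = D (a - u, 0) + e (m a - m u) := by
      rw [← ContinuousLinearEquiv.coe_coe e, ← he]
      simp [← map_add]
    rw [hsplit]
    simp [hL, add_comm]
  have hLO : (fun a ↦ L (a - u)) =O[𝓝 u] fun a ↦ a - u := L.isBigO_comp _ _
  have h3 : (fun a ↦ m a - m u) =O[𝓝 u] fun a ↦ a - u := by
    -- The error is negligible against the pair of increments, so the pair is controlled by `(a - u,
    -- -L (a - u))`, hence by `a - u`.
    have h4 : (fun a ↦ ((0, m a - m u + L (a - u)) : X × Y)) =o[𝓝 u]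
        fun a ↦ (a - u, m a - m u) := (Asymptotics.isLittleO_zero _ _).prod_left h2
    refine Asymptotics.isBigO_snd_prod.trans (h4.right_isBigO_sub.trans ?_)
    refine ((Asymptotics.isBigO_refl _ _).prod_left hLO.neg_left).congr_left fun a ↦ ?_
    simp
  refine .of_isLittleO ((h2.trans_isBigO ((Asymptotics.isBigO_refl _ _).prod_left h3)).congr_left
    fun a ↦ ?_)
  rw [neg_apply, sub_neg_eq_add]

/-- The partial gradient of a twice differentiable function is differentiable. -/
theorem TwiceDifferentiableAt.differentiableAt_gradient_snd {X Y : Type*} [NormedAddCommGroup X]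
    [NormedSpace ℝ X] [NormedAddCommGroup Y] [InnerProductSpace ℝ Y] [CompleteSpace Y]
    {F : X → Y → ℝ} {p : X × Y} (hF : TwiceDifferentiableAt (fun q : X × Y ↦ F q.1 q.2) p) :
    DifferentiableAt ℝ (fun q : X × Y ↦ gradient (F q.1) q.2) p := by
  have h : DifferentiableAt ℝ (fun q : X × Y ↦ (InnerProductSpace.toDual ℝ Y).symm
      ((fderiv ℝ (fun q : X × Y ↦ F q.1 q.2) q) ∘L ContinuousLinearMap.inr ℝ X Y)) p :=
    (InnerProductSpace.toDual ℝ Y).symm.toContinuousLinearEquiv.differentiableAt.comp p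
      (hF.2.clm_comp (differentiableAt_const _))
  refine h.congr_of_eventuallyEq ?_
  filter_upwards [hF.1] with q hq
  have hs : HasFDerivAt (F q.1)
      ((fderiv ℝ (fun q : X × Y ↦ F q.1 q.2) q) ∘L ContinuousLinearMap.inr ℝ X Y) q.2 :=
    HasFDerivAt.comp (g := fun q : X × Y ↦ F q.1 q.2) (f := fun v ↦ (q.1, v)) q.2 hq.hasFDerivAt
      (hasFDerivAt_prodMk_right q.1 q.2)
  rw [gradient, hs.fderiv]

theorem mainTheorem1 {n t : ℕ}
    {M : Type*} [EMetricSpace M] [ChartedSpace (EuclideanSpace ℝ (Fin n)) M]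
    [IsManifold (𝓡 n) ∞ M]
    [RiemannianBundle (fun (p : M) ↦ TangentSpace (𝓡 n) p)]
    [IsContMDiffRiemannianBundle (𝓡 n) ∞ (EuclideanSpace ℝ (Fin n))
      (fun (p : M) ↦ TangentSpace (𝓡 n) p)]
    [IsRiemannianManifold (𝓡 n) M]
    -- weights, data points, and the Fréchet mean near the data points
    (w : Fin t → ℝ) (hw : ∀ l, 0 < w l) (x : Fin t → M) (μ : (Fin t → M) → M)
    (hμ : ∀ᶠ x' in 𝓝 x, μ x' ∈ frechetArgmin w x')
    (hμx : frechetArgmin w x = {μ x})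
    (hreg : CompleteSpace M ∨ ContinuousAt μ x)
    -- local coordinates around the data points and around the mean
    (φ : Fin t → OpenPartialHomeomorph M (EuclideanSpace ℝ (Fin n)))
    (hφ : ∀ l, φ l ∈ IsManifold.maximalAtlas (𝓡 n) ∞ M) (hxφ : ∀ l, x l ∈ (φ l).source)
    (ψ : OpenPartialHomeomorph M (EuclideanSpace ℝ (Fin n)))
    (hψ : ψ ∈ IsManifold.maximalAtlas (𝓡 n) ∞ M) (hxψ : μ x ∈ ψ.source)
    -- the objective is twice differentiable at `({x}, x̄)`, with invertible Hessian in `y`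
    (hf : TwiceDifferentiableAt (fun p : (Fin t → EuclideanSpace ℝ (Fin n)) ×
      EuclideanSpace ℝ (Fin n) ↦ coordObjective w φ ψ p.1 p.2) (fun l ↦ φ l (x l), ψ (μ x)))
    (hinv : (hessYY (coordObjective w φ ψ) (fun l ↦ φ l (x l)) (ψ (μ x))).IsInvertible) :
    ContinuousAt μ x ∧
    DifferentiableAt ℝ (coordMap φ ψ μ) (fun l ↦ φ l (x l)) ∧
    ∀ i : Fin t, HasFDerivAt
      (fun a ↦ coordMap φ ψ μ (Function.update (fun l ↦ φ l (x l)) i a))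
      (-((hessYY (coordObjective w φ ψ) (fun l ↦ φ l (x l)) (ψ (μ x))).inverse ∘L
          mixedXY (coordObjective w φ ψ) i (fun l ↦ φ l (x l)) (ψ (μ x))))
      (φ i (x i)) := by
  have hcont : ContinuousAt μ x := by
    rcases hreg with hM | h
    · have : LocallyCompactSpace M := ChartedSpace.locallyCompactSpace (EuclideanSpace ℝ (Fin n)) M
      refine continuousAt_of_mem_frechetArgmin (fun p r ↦ ?_) hw hμ hμx
      exact isCompact_closedEBall_of_length_space
        (fun _ _ _ _ ↦ IsRiemannianManifold.exists_edist_le_edist_lt (𝓡 n)) p r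
    · exact h
  set u₀ : Fin t → EuclideanSpace ℝ (Fin n) := fun l ↦ φ l (x l) with hu₀
  set F := coordObjective w φ ψ with hF
  have hm₀ : coordMap φ ψ μ u₀ = ψ (μ x) := by
    simp [coordMap, hu₀, (φ _).left_inv (hxφ _)]
  have hx : Tendsto (fun u : Fin t → EuclideanSpace ℝ (Fin n) ↦ fun l ↦ (φ l).symm (u l))
      (𝓝 u₀) (𝓝 x) :=
    tendsto_pi_nhds.2 fun l ↦
      ((φ l).tendsto_symm (hxφ l)).comp ((continuous_apply l).tendsto u₀)
  have hμx' : Tendsto (fun u : Fin t → EuclideanSpace ℝ (Fin n) ↦ μ fun l ↦ (φ l).symm (u l))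
      (𝓝 u₀) (𝓝 (μ x)) := Tendsto.comp hcont hx
  have hm : ContinuousAt (coordMap φ ψ μ) u₀ := by
    rw [ContinuousAt, hm₀]
    exact (ψ.continuousAt hxψ).tendsto.comp hμx'
  -- Finiteness nearby is essential: `toReal` sends `⊤` to 0, which could destroy minimality.
  have hfin : ∀ᶠ p : (Fin t → M) × M in 𝓝 (x, μ x), frechetObjective w p.1 p.2 < ⊤ :=
    (continuous_frechetObjective w).continuousAt.eventually_lt continuousAt_const
      (frechetObjective_ne_top hμx).lt_top
  obtain ⟨A, hA, B, hB, hAB⟩ := mem_nhds_prod_iff.1 hfin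
  -- the first-order condition at the minimizers
  have hzero : ∀ᶠ u in 𝓝 u₀, gradient (F u) (coordMap φ ψ μ u) = 0 := by
    filter_upwards [hx hμ, hx hA, hμx' (ψ.open_source.mem_nhds hxψ),
      hμx' (mem_interior_iff_mem_nhds.2 hB |> isOpen_interior.mem_nhds)] with u hmin huA hsrc huB
    simp only [mem_preimage, mem_ofPred_eq] at hmin huA hsrc huB
    have hloc : IsLocalMin (F u) (coordMap φ ψ μ u) := by
      have hnear : ∀ᶠ v in 𝓝 (coordMap φ ψ μ u), ψ.symm v ∈ B :=
        ψ.tendsto_symm hsrc (mem_interior_iff_mem_nhds.1 huB)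
      filter_upwards [hnear] with v hv
      refine ENNReal.toReal_mono (hAB (mk_mem_prod huA hv)).ne ?_
      rw [coordMap, ψ.left_inv hsrc]
      exact hmin _
    simp [gradient, hloc.fderiv_eq_zero]
  have hG := hf.differentiableAt_gradient_snd.hasFDerivAt
  set D := fderiv ℝ (fun q : (Fin t → EuclideanSpace ℝ (Fin n)) × EuclideanSpace ℝ (Fin n) ↦
    gradient (F q.1) q.2) (u₀, ψ (μ x))
  have hY : hessYY F u₀ (ψ (μ x)) = D ∘L ContinuousLinearMap.inr ℝ _ _ :=
    (hG.comp (ψ (μ x)) (hasFDerivAt_prodMk_right u₀ (ψ (μ x)))).fderiv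
  have hX : ∀ i, mixedXY F i u₀ (ψ (μ x)) =
      D ∘L ContinuousLinearMap.inl ℝ _ _ ∘L ContinuousLinearMap.pi (Pi.single i (.id ℝ _)) := by
    intro i
    have hupd := hasFDerivAt_update (𝕜 := ℝ) u₀ (i := i) (u₀ i)
    have hpair := (hasFDerivAt_prodMk_left (𝕜 := ℝ) u₀ (ψ (μ x)))
    rw [← Function.update_eq_self i u₀] at hG hpair
    exact (hG.comp (u₀ i) (hpair.comp (u₀ i) hupd)).fderiv
  obtain ⟨e, he⟩ := hinv
  rw [← hm₀] at hG
  have hder := hG.of_implicit hm hzero e (by rw [he, hY])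
  refine ⟨hcont, hder.differentiableAt, fun i ↦ ?_⟩
  rw [← he, ContinuousLinearMap.inverse_equiv, hX i]
  have hupd := hasFDerivAt_update (𝕜 := ℝ) u₀ (i := i) (u₀ i)
  rw [← Function.update_eq_self i u₀] at hder
  exact hder.comp (u₀ i) hupd
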